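/- Let $\mathfrak{c} = 2^{\aleph_0}$ and let $\eta$ be the Euclidean topology on $\mathbb{R}$. A topology $\tau \supseteq \eta$ on $\mathbb{R}$ is called strictly finer than $\eta$ at a point $x$ if the neighborhood filters of $x$ with respect to $\tau$ and $\eta$ are different. **Theorem 6.** There exists a set $\mathcal{S}$ of topologies on $\mathbb{R}$ of cardinality $|\mathcal{S}| = 2^{2^{\mathfrak{c}}}$ such that 1. every $\tau \in \mathcal{S}$ is finer than $\eta$ and is strictly finer than $\eta$ at every point $x \in \mathbb{R}$; 2. for every $\tau \in \mathcal{S}$ the space $(\mathbb{R}, \tau)$ is Hausdorff, separable and connected; 3. the spaces $(\mathbb{R}, \tau)$, $\tau \in \mathcal{S}$, are incomparable: whenever $\tau, \sigma \in \mathcal{S}$ and $(\mathbb{R}, \tau)$ is homeomorphic to a subspace $S$ of $(\mathbb{R}, \sigma)$, then $\tau = \sigma$ and $S = \mathbb{R}$. In other words, the spaces are mutually non-homeomorphic, and none of them is homeomorphic to a proper subspace of itself or of any other of them. -/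

import Mathlib

/-- The natural Euclidean topology `η` on the real line. -/
abbrev euclideanTopology : TopologicalSpace ℝ := inferInstance

/-- The family of all topologies on `ℝ` that are finer than the Euclidean topology
(every Euclidean open set is open). -/
def refinements : Set (TopologicalSpace ℝ) :=
  {τ | ∀ U : Set ℝ, @IsOpen ℝ euclideanTopology U → @IsOpen ℝ τ U}

/-- `Γ(τ)`: the set of all points at which the neighbourhood filter of `τ` differs from the
Euclidean one. For `τ` in `refinements` these are the points at which `τ` is strictly finer than
the Euclidean topology. -/
def strictPoints (τ : TopologicalSpace ℝ) : Set ℝ :=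
  {x | @nhds ℝ euclideanTopology x ≠ @nhds ℝ τ x}

/-- The spaces `(X, τ)`, `τ ∈ 𝒮`, are incomparable: for `τ, σ ∈ 𝒮` the space `(X, τ)` is
homeomorphic to a subspace `S` of `(X, σ)` only in the trivial case that `τ = σ` and `S` is the
whole space. -/
def Incomparable {X : Type*} (𝒮 : Set (TopologicalSpace X)) : Prop :=
  ∀ τ ∈ 𝒮, ∀ σ ∈ 𝒮, ∀ S : Set X,
    Nonempty (@Homeomorph X S τ (TopologicalSpace.induced (Subtype.val : S → X) σ)) →
      τ = σ ∧ S = Set.univ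

/-! Transfinite recursion against all continuous injective self-maps produces a dense set `D` such
that each of them, on each nonempty open set without fixed points, moves a point of `D` out of `D`.
Refine the topology by declaring the traces `V ∩ D ∪ {x}` of neighbourhoods `V` of `x` to be
neighbourhoods of `x`. As `D` is dense, a map into a regular space is continuous for the refinement
only if it was continuous before, so connectedness survives and continuous injections are among the
maps handled in the recursion; the sets `D ∪ {x}` being open, the choice of `D` leaves only the
identity.

This argument never looks at one chosen point `p ∉ D`, so the neighbourhoods of `p` may also be
required to belong to any filter strictly below `𝓝[(D ∪ {p})ᶜ] p`. Distinct filters give distinct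
topologies, and there are as many of them as there are filters on the whole space. -/

open Set Filter Topology Function Cardinal

universe u

section Choice

variable {ι α β : Type u} {κ : Cardinal.{u}}

theorem mk_iUnion_lt_of_countable (hκ : ℵ₀ < κ) (hι : #ι < κ) {B : ι → Set α}
    (hB : ∀ i, (B i).Countable) : #(⋃ i, B i) < κ :=
  calc
    #(⋃ i, B i) ≤ #ι * ⨆ i, #(B i) := mk_iUnion_le B
    _ ≤ #ι * ℵ₀ := by gcongr; exact ciSup_le' fun i => (hB i).le_aleph0
    _ < κ := mul_lt_of_lt hκ.le hι hκ

theorem exists_mem_disjoint_of_mk_lt (hκ : ℵ₀ < κ) {A : Set β} (hA : κ ≤ #A) {S : β → Set α}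
    (hS : ∀ a, {x | a ∈ S x}.Countable) {W : Set α} (hW : #W < κ) :
    ∃ x ∈ A, Disjoint (S x) W := by
  by_contra! h
  have hcover : A ⊆ ⋃ a : W, {x | ↑a ∈ S x} := fun x hx => by
    obtain ⟨a, haS, haW⟩ := not_disjoint_iff.1 (h x hx)
    exact mem_iUnion.2 ⟨⟨a, haW⟩, haS⟩
  exact ((mk_iUnion_lt_of_countable hκ hW fun a => hS a).trans_le hA).not_ge
    (mk_le_mk_of_subset hcover)

theorem exists_choice_pairwise_disjoint (hκ : ℵ₀ < κ) (hι : #ι ≤ κ) {A : ι → Set β}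
    (hA : ∀ i, κ ≤ #(A i)) {S : ι → β → Set α} (hS : ∀ i x, (S i x).Countable)
    (hS' : ∀ i a, {x | a ∈ S i x}.Countable) :
    ∃ z : ι → β, (∀ i, z i ∈ A i) ∧ Pairwise (Disjoint on fun i => S i (z i)) := by
  obtain ⟨_, _, hord⟩ := exists_ord_eq_type_lt ι
  have exists_next (i : ι) (g : ∀ j, j < i → β) :
      ∃ x ∈ A i, Disjoint (S i x) (⋃ j : Iio i, S j (g j j.2)) :=
    exists_mem_disjoint_of_mk_lt hκ (hA i) (hS' i)
      (mk_iUnion_lt_of_countable hκ ((mk_Iio_lt i hord).trans_le hι) fun _ => hS _ _)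
  choose next hnext hdisj using exists_next
  let z : ι → β := wellFounded_lt.fix next
  have hz (i : ι) : z i = next i fun j _ => z j := wellFounded_lt.fix_eq next i
  have hlt {i j : ι} (hij : j < i) : Disjoint (S i (z i)) (S j (z j)) := by
    rw [hz i]
    exact (hdisj i fun j _ => z j).mono_right
      (subset_iUnion (fun j : Iio i => S j (z j)) ⟨j, hij⟩)
  refine ⟨z, fun i => hz i ▸ hnext i _, fun i j hij => ?_⟩
  exact hij.lt_or_gt.elim (fun h => (hlt h).symm) hlt

theorem exists_injective_choice (hκ : ℵ₀ < κ) (hι : #ι ≤ κ) {A : ι → Set α}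
    (hA : ∀ i, κ ≤ #(A i)) : ∃ z : ι → α, Injective z ∧ ∀ i, z i ∈ A i := by
  obtain ⟨z, hzA, hz⟩ := exists_choice_pairwise_disjoint hκ hι hA (S := fun _ x => {x})
    (fun _ => countable_singleton) fun _ a => by simp
  refine ⟨z, fun i j hij => by_contra fun hne => ?_, hzA⟩
  simpa [hij] using hz hne

theorem exists_set_forall_le_mk_sdiff_preimage (hκ : ℵ₀ < κ) (hι : #ι ≤ κ) {A : ι → Set α}
    (hA : ∀ i, κ ≤ #(A i)) {f : ι → α → α} (hf : ∀ i, Injective (f i))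
    (hfA : ∀ i, ∀ x ∈ A i, f i x ≠ x) :
    ∃ D : Set α, ∀ i, κ ≤ #↥((A i ∩ D) \ f i ⁻¹' D) := by
  have hικ : #(ι × κ.out) ≤ κ := by
    simpa using mul_le_of_le hκ.le hι le_rfl
  obtain ⟨z, hzA, hz⟩ := exists_choice_pairwise_disjoint hκ hικ (fun q => hA q.1)
    (S := fun q x => {x, f q.1 x}) (fun _ _ => (countable_singleton _).insert _) fun q a => by
      refine ((countable_singleton a).union ((countable_singleton a).preimage (hf q.1))).mono ?_
      rintro x (rfl | rfl) <;> simp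
  have hne {q r : ι × κ.out} (hqr : q ≠ r) : z q ≠ z r ∧ z q ≠ f r.1 (z r) := by
    simpa using (disjoint_left.1 (hz hqr) (mem_insert _ _))
  have himage (q : ι × κ.out) : f q.1 (z q) ∉ range z := by
    rintro ⟨r, hr⟩
    obtain rfl | hrq := eq_or_ne r q
    · exact hfA _ _ (hzA r) hr.symm
    · exact (hne hrq).2 hr
  refine ⟨range z, fun i => ?_⟩
  have hinj : Injective fun t => (⟨z (i, t), ⟨hzA (i, t), mem_range_self _⟩, himage (i, t)⟩ :
      ↥((A i ∩ range z) \ f i ⁻¹' range z)) := fun s t hst => by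
    by_contra hne'
    exact (hne (fun h => hne' (congrArg Prod.snd h))).1 (congrArg Subtype.val hst)
  exact (mk_out κ).ge.trans (mk_le_of_injective hinj)

theorem exists_injective_forall_mem_ne {s : Set α} (hs : s.Infinite) :
    ∃ f : α → α, Injective f ∧ ∀ x ∈ s, f x ∈ s ∧ f x ≠ x := by
  classical
  have := hs.to_subtype
  obtain ⟨e⟩ : Nonempty (s ⊕ s ≃ s) := Cardinal.eq.1 (by simp [add_eq_self (aleph0_le_mk s)])
  let g : Equiv.Perm s := e.symm.trans ((Equiv.sumComm s s).trans e)
  have hg (x : s) : g x ≠ x := fun h => by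
    have hswap : (e.symm x).swap = e.symm x := e.injective (by simpa [g] using h)
    cases hx : e.symm x <;> simp [hx] at hswap
  refine ⟨g.ofSubtype, g.ofSubtype.injective, fun x hx => ?_⟩
  rw [Equiv.Perm.ofSubtype_apply_of_mem g hx]
  exact ⟨(g ⟨x, hx⟩).2, fun h => hg ⟨x, hx⟩ (Subtype.ext h)⟩

theorem exists_set_le_mk_sdiff_preimage_of_mem (hκ : ℵ₀ < κ) {𝓕 : Set (α → α)} (h𝓕 : #𝓕 ≤ κ)
    (hinj : ∀ f ∈ 𝓕, Injective f) {𝓤 : Set (Set α)} (h𝓤 : #𝓤 ≤ κ) (hcard : ∀ U ∈ 𝓤, κ ≤ #U) :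
    ∃ D : Set α, (∀ U ∈ 𝓤, ∀ f ∈ 𝓕, (∀ x ∈ U, f x ≠ x) → κ ≤ #↥((U ∩ D) \ f ⁻¹' D)) ∧
      ∀ U ∈ 𝓤, κ ≤ #↥(U ∩ D) ∧ κ ≤ #↥(U \ D) := by
  choose g hg hgU using fun U : 𝓤 => exists_injective_forall_mem_ne <|
    infinite_coe_iff.1 (infinite_iff.2 (hκ.le.trans (hcard U U.2)))
  let 𝓖 : Set (α → α) := 𝓕 ∪ range g
  have h𝓖 : #𝓖 ≤ κ :=
    (mk_union_le _ _).trans (add_le_of_le hκ.le h𝓕 (mk_range_le.trans h𝓤))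
  have h𝓖inj : ∀ f ∈ 𝓖, Injective f := by
    rintro f (hf | ⟨U, rfl⟩)
    exacts [hinj f hf, hg U]
  obtain ⟨D, hD⟩ := exists_set_forall_le_mk_sdiff_preimage hκ
    (ι := {q : 𝓖 × 𝓤 // ∀ x ∈ (q.2 : Set α), (q.1 : α → α) x ≠ x})
    ((mk_subtype_le _).trans (mul_le_of_le hκ.le h𝓖 h𝓤))
    (fun q => hcard q.1.2 q.1.2.2) (fun q => h𝓖inj q.1.1 q.1.1.2) (fun q => q.2)
  have hgD (U : 𝓤) : κ ≤ #↥((↑U ∩ D) \ g U ⁻¹' D) :=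
    hD ⟨(⟨g U, Or.inr (mem_range_self U)⟩, U), fun x hx => (hgU U x hx).2⟩
  refine ⟨D, fun U hU f hf hfU => hD ⟨(⟨f, Or.inl hf⟩, ⟨U, hU⟩), hfU⟩, fun U hU => ⟨?_, ?_⟩⟩
  · exact (hgD ⟨U, hU⟩).trans (mk_le_mk_of_subset sdiff_subset)
  · calc
      κ ≤ #↥((U ∩ D) \ g ⟨U, hU⟩ ⁻¹' D) := hgD ⟨U, hU⟩
      _ = #(g ⟨U, hU⟩ '' ((U ∩ D) \ g ⟨U, hU⟩ ⁻¹' D)) := (mk_image_eq (hg _)).symm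
      _ ≤ #↥(U \ D) := mk_le_mk_of_subset <| image_subset_iff.2 fun x hx =>
        ⟨(hgU ⟨U, hU⟩ x hx.1.1).1, hx.2⟩

end Choice

section Filters

variable {α : Type u}

theorem injective_comap_nhds_of_denseRange {Y : Type*} [TopologicalSpace Y] [T2Space Y] {e : α → Y}
    (he : DenseRange e) : Injective fun y => comap e (𝓝 y) := by
  intro y z hyz
  have : (comap e (𝓝 y)).NeBot :=
    comap_neBot_iff_frequently.2 (mem_closure_iff_frequently.1 (he y))
  exact tendsto_nhds_unique tendsto_comap (tendsto_comap.mono_left (Eq.le hyz))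

open scoped Classical in
theorem exists_finset_injOn_filter_mem (T : Finset (Set α)) :
    ∃ s : Finset α, InjOn (fun A : Set α => s.filter (· ∈ A)) T := by
  have hsep (A B : Set α) :
      ∀ᶠ s : Finset α in atTop, s.filter (· ∈ A) = s.filter (· ∈ B) → A = B := by
    by_cases hAB : A = B
    · exact .of_forall fun _ _ => hAB
    · obtain ⟨x, hx⟩ := not_forall.1 (mt Set.ext hAB)
      filter_upwards [eventually_ge_atTop {x}] with s hs h
      have hxs : x ∈ s := hs (Finset.mem_singleton_self x)
      exact absurd (by simpa [hxs] using Finset.ext_iff.1 h x) hx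
  have hall : ∀ᶠ s : Finset α in atTop, ∀ A ∈ T, ∀ B ∈ T,
      s.filter (· ∈ A) = s.filter (· ∈ B) → A = B := by
    simp only [Filter.eventually_all_finset]
    exact fun A _ B _ => hsep A B
  obtain ⟨s, hs⟩ := hall.exists
  exact ⟨s, fun A hA B hB => hs A hA B hB⟩

open scoped Classical in
/-- The evaluation map of the Fichtenholz-Kantorovich-Hausdorff independent family: the `A`-th
member of the family consists of the pairs `(s, 𝒯)` with `s ∩ A ∈ 𝒯`. -/
noncomputable def independentFamily (q : Finset α × Finset (Finset α)) (A : Set α) : Bool :=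
  decide (q.1.filter (· ∈ A) ∈ q.2)

theorem denseRange_independentFamily : DenseRange (independentFamily (α := α)) := by
  classical
  intro b
  have happrox (T : Finset (Set α)) : ∃ q, ∀ A ∈ T, independentFamily q A = b A := by
    obtain ⟨s, hs⟩ := exists_finset_injOn_filter_mem T
    refine ⟨(s, (T.filter (b · = true)).image fun A => s.filter (· ∈ A)), fun A hA => ?_⟩
    rw [independentFamily, Bool.eq_iff_iff, decide_eq_true_iff, Finset.mem_image]
    constructor
    · rintro ⟨B, hB, hBA⟩
      rw [Finset.mem_filter] at hB
      exact hs hB.1 hA hBA ▸ hB.2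
    · exact fun h => ⟨A, Finset.mem_filter.2 ⟨hA, h⟩, rfl⟩
  choose q hq using happrox
  have hlim : Tendsto (fun T => independentFamily (q T)) atTop (𝓝 b) :=
    tendsto_pi_nhds.2 fun A => tendsto_const_nhds.congr' <| by
      filter_upwards [eventually_ge_atTop {A}] with T hT
      exact (hq T A (hT (Finset.mem_singleton_self A))).symm
  exact mem_closure_of_tendsto hlim (.of_forall fun T => mem_range_self _)

theorem mk_filter (α : Type u) [Infinite α] : 
    #(Filter α) = (2 : Cardinal.{u}) ^ (2 : Cardinal.{u}) ^ #α := by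
  apply le_antisymm
  · rw [← mk_set, ← mk_set]
    exact mk_le_of_injective (f := Filter.sets) fun _ _ => Filter.filter_eq
  · obtain ⟨e⟩ : Nonempty (Finset α × Finset (Finset α) ≃ α) :=
      Cardinal.eq.1 (by simp [mul_eq_self (aleph0_le_mk α)])
    have hinj := (map_injective e.injective).comp
      (injective_comap_nhds_of_denseRange (denseRange_independentFamily (α := α)))
    simpa using mk_le_of_injective hinj

theorem mk_Iic_filter (hα : ℵ₀ < #α) {l : Filter α} [l.IsCountablyGenerated]
    (hl : ∀ s ∈ l, #α ≤ #s) : #(Iic l) = (2 : Cardinal.{u}) ^ (2 : Cardinal.{u}) ^ #α := by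
  have := infinite_iff.2 hα.le
  refine le_antisymm (mk_filter α ▸ mk_set_le _) ?_
  obtain ⟨s, hs⟩ := l.exists_antitone_basis
  obtain ⟨φ, hφ, hφs⟩ := exists_injective_choice (ι := ULift.{u} ℕ × α) hα (by simp [hα.le])
    fun q => hl (s q.1.down) (hs.mem q.1.down)
  -- The factor `ℕ` pushes the image below `l`, and `F` is recovered by projecting to the other one.
  have hle (F : Filter α) : map φ (comap ULift.down atTop ×ˢ F) ≤ l := by
    refine hs.tendsto_right_iff.2 fun n _ => ?_
    filter_upwards [prod_mem_prod (preimage_mem_comap (Ici_mem_atTop n)) univ_mem] with q hq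
    exact hs.antitone hq.1 (hφs q)
  have hinj : Injective fun F => (⟨map φ (comap ULift.down atTop ×ˢ F), hle F⟩ : Iic l) := by
    intro F F' h
    have : (comap ULift.down (atTop : Filter ℕ)).NeBot :=
      NeBot.comap_of_surj inferInstance ULift.down_surjective
    have := congrArg (map Prod.snd) (map_injective hφ (congrArg Subtype.val h))
    rwa [map_snd_prod, map_snd_prod] at this
  exact mk_filter α ▸ mk_le_of_injective hinj

theorem mk_Iio_filter (hα : ℵ₀ < #α) {l : Filter α} [l.IsCountablyGenerated]
    (hl : ∀ s ∈ l, #α ≤ #s) : #(Iio l) = (2 : Cardinal.{u}) ^ (2 : Cardinal.{u}) ^ #α := by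
  have hadd : #(Iio l) + 1 = (2 : Cardinal.{u}) ^ (2 : Cardinal.{u}) ^ #α := by
    rw [← mk_Iic_filter hα hl, ← Iio_insert, mk_insert self_notMem_Iio]
  have hinf : ℵ₀ ≤ (2 : Cardinal.{u}) ^ (2 : Cardinal.{u}) ^ #α :=
    hα.le.trans ((cantor _).trans (cantor _)).le
  rw [← add_one_eq hinf] at hadd
  exact add_one_inj.1 hadd

end Filters

section Cardinality

theorem nonempty_of_continuum_le_mk {α : Type*} {s : Set α} (hs : 𝔠 ≤ #s) : s.Nonempty :=
  nonempty_coe_sort.1 (mk_ne_zero_iff.1 (continuum_pos.trans_le hs).ne')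

variable {X Y : Type u} [TopologicalSpace X]

theorem continuum_le_mk_of_isOpen [CompletelyRegularSpace X] [T1Space X] [ConnectedSpace X]
    [Nontrivial X] {U : Set X} (hU : IsOpen U) (hne : U.Nonempty) : 𝔠 ≤ #U := by
  obtain ⟨x, hx⟩ := hne
  obtain ⟨y, hyx⟩ := exists_ne x
  obtain ⟨f, hf, hfx, hfK⟩ := CompletelyRegularSpace.completely_regular x (Uᶜ ∪ {y})
    (hU.isClosed_compl.union isClosed_singleton) (by simp [hx, hyx.symm])
  let g (w : X) : ℝ := f w
  have hsub : Ico 0 1 ⊆ g '' U := fun r hr => by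
    obtain ⟨w, hw⟩ := mem_range_of_exists_le_of_exists_ge (continuous_subtype_val.comp hf)
      ⟨x, (congrArg Subtype.val hfx).trans_le hr.1⟩
      ⟨y, (congrArg Subtype.val (hfK (Or.inr rfl))).ge.trans' hr.2.le⟩
    refine ⟨w, by_contra fun hwU => hr.2.ne ?_, hw⟩
    exact hw.symm.trans (congrArg Subtype.val (hfK (Or.inl hwU)))
  have hlift : lift.{u} #(Ico (0 : ℝ) 1) ≤ #U :=
    (lift_le.2 (mk_le_mk_of_subset hsub)).trans (by simpa using mk_image_le_lift (f := g) (s := U))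
  rwa [mk_Ico_real zero_lt_one, lift_continuum] at hlift

theorem mk_le_continuum_of_secondCountable [SecondCountableTopology X] [T0Space X] : #X ≤ 𝔠 := by
  let B := TopologicalSpace.countableBasis X
  have hinj : Injective fun x : X => {U : B | x ∈ (U : Set X)} := fun x y hxy =>
    ((TopologicalSpace.isBasis_countableBasis X).inseparable_iff.2 fun U hU =>
      Set.ext_iff.1 hxy ⟨U, hU⟩).eq
  calc
    #X ≤ #(Set B) := mk_le_of_injective hinj
    _ = 2 ^ #B := mk_set
    _ ≤ 2 ^ ℵ₀ := power_le_power_left two_ne_zero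
      (TopologicalSpace.countable_countableBasis X).le_aleph0
    _ = 𝔠 := two_power_aleph0

theorem mk_continuousMap_le_continuum [TopologicalSpace.SeparableSpace X] [TopologicalSpace Y]
    [SecondCountableTopology Y] [T2Space Y] : #C(X, Y) ≤ 𝔠 := by
  obtain ⟨s, hsc, hs⟩ := TopologicalSpace.exists_countable_dense X
  have hinj : Injective fun (f : C(X, Y)) (x : s) => f x := fun f g h => ContinuousMap.ext <|
    congrFun (f.continuous.ext_on hs g.continuous fun x hx => congrFun h ⟨x, hx⟩)
  calc
    #C(X, Y) ≤ #Y ^ #s := by simpa using mk_le_of_injective hinj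
    _ ≤ 𝔠 ^ #s := power_le_power_right mk_le_continuum_of_secondCountable
    _ ≤ 𝔠 ^ ℵ₀ := power_le_power_left continuum_ne_zero hsc.le_aleph0
    _ = 𝔠 := continuum_power_aleph0

end Cardinality

section Rigid

variable {X : Type u} [TopologicalSpace X]

/-- A set is rigid if every injective continuous self-map moves some point of the set out of it on
each nonempty open set without fixed points. -/
def IsRigid (D : Set X) : Prop :=
  ∀ f : X → X, Continuous f → Injective f → ∀ U : Set X, IsOpen U → U.Nonempty →
    (∀ x ∈ U, f x ≠ x) → ∃ x ∈ U, x ∈ D ∧ f x ∉ D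

theorem exists_isRigid [SecondCountableTopology X] [T2Space X]
    (hX : ∀ U : Set X, IsOpen U → U.Nonempty → 𝔠 ≤ #U) :
    ∃ D : Set X, IsRigid D ∧ Dense D ∧ ∀ U : Set X, IsOpen U → U.Nonempty → 𝔠 ≤ #↥(U \ D) := by
  let B := TopologicalSpace.countableBasis X
  have hbasis : TopologicalSpace.IsTopologicalBasis B := TopologicalSpace.isBasis_countableBasis X
  have hBcard : #B ≤ 𝔠 :=
    (TopologicalSpace.countable_countableBasis X).le_aleph0.trans aleph0_le_continuum
  obtain ⟨D, hD, hDB⟩ := exists_set_le_mk_sdiff_preimage_of_mem aleph0_lt_continuum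
    (𝓕 := (⇑) '' {f : C(X, X) | Injective f})
    (mk_image_le.trans ((mk_set_le _).trans mk_continuousMap_le_continuum))
    (by rintro _ ⟨f, hf, rfl⟩; exact hf) hBcard
    fun V hV => hX V (hbasis.isOpen hV) (TopologicalSpace.nonempty_of_mem_countableBasis hV)
  have hsub {U : Set X} (hU : IsOpen U) (hne : U.Nonempty) : ∃ V ∈ B, V ⊆ U := by
    obtain ⟨x, hx⟩ := hne
    obtain ⟨V, hV, -, hVU⟩ := hbasis.exists_subset_of_mem_open hx hU
    exact ⟨V, hV, hVU⟩
  refine ⟨D, fun f hf hinj U hU hne hfU => ?_, ?_, fun U hU hne => ?_⟩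
  · obtain ⟨V, hV, hVU⟩ := hsub hU hne
    obtain ⟨x, ⟨hxV, hxD⟩, hfx⟩ := nonempty_of_continuum_le_mk
      (hD V hV f ⟨⟨f, hf⟩, hinj, rfl⟩ fun x hx => hfU x (hVU hx))
    exact ⟨x, hVU hxV, hxD, hfx⟩
  · exact hbasis.dense_iff.2 fun V hV _ => nonempty_of_continuum_le_mk (hDB V hV).1
  · obtain ⟨V, hV, hVU⟩ := hsub hU hne
    exact (hDB V hV).2.trans (mk_le_mk_of_subset (sdiff_subset_sdiff_left hVU))

end Rigid

section TraceTopology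

variable {X : Type*} {τ : TopologicalSpace X} [t : TopologicalSpace X] {D : Set X}

/-- The topology in which the neighbourhoods of `x` are generated by the traces on `D ∪ {x}` of its
original neighbourhoods. -/
abbrev traceTopology (D : Set X) : TopologicalSpace X :=
  .mkOfNhds (𝓝[D] ·)

theorem isOpen_traceTopology_iff {U : Set X} :
    IsOpen[traceTopology D] U ↔ ∀ x ∈ U, U ∈ 𝓝[D] x :=
  Iff.rfl

theorem traceTopology_le : traceTopology D ≤ t :=
  fun _ hU _ hx => mem_nhdsWithin_of_mem_nhds (hU.mem_nhds hx)

theorem isOpen_traceTopology_of_subset {U : Set X} (hU : D ⊆ U) : IsOpen[traceTopology D] U :=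
  fun _ _ => mem_of_superset self_mem_nhdsWithin hU

theorem continuous_of_traceTopology_le {Y : Type*} [TopologicalSpace Y] [T3Space Y] (hD : Dense D)
    (hτ : traceTopology D ≤ τ) {f : X → Y} (hf : Continuous[τ, _] f) : Continuous f := by
  have hlim (x : X) : Tendsto f (𝓝[D] x) (𝓝 (f x)) := tendsto_nhds.2 fun V hV hx =>
    isOpen_traceTopology_iff.1 (continuous_def.1 (continuous_le_dom hτ hf) V hV) x hx
  have hext : extendFrom D f = f := funext fun x => extendFrom_eq (hD x) (hlim x)
  exact hext ▸ continuous_extendFrom hD fun x => ⟨_, hlim x⟩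

theorem connectedSpace_of_traceTopology_le [ConnectedSpace X] (hD : Dense D)
    (hτ : traceTopology D ≤ τ) : @ConnectedSpace X τ := by
  refine @ConnectedSpace.mk X τ (@preconnectedSpace_of_forall_constant X τ fun f hf x y => ?_)
    inferInstance
  exact PreconnectedSpace.constant inferInstance (continuous_of_traceTopology_le hD hτ hf)

theorem separableSpace_of_traceTopology_le [TopologicalSpace.SeparableSpace D] (hD : Dense D)
    (hτ : traceTopology D ≤ τ) : @TopologicalSpace.SeparableSpace X τ := by
  obtain ⟨C, hCD, hC, hCdense⟩ := hD.exists_countable_dense_subset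
  refine @TopologicalSpace.SeparableSpace.mk X τ ⟨C, hC, ?_⟩
  rw [@dense_iff_inter_open X τ]
  rintro U hU ⟨x, hx⟩
  obtain ⟨V, hV, hxV, hVU⟩ := mem_nhdsWithin.1 (isOpen_traceTopology_iff.1 (hτ U hU) x hx)
  obtain ⟨y, hyV, hyC⟩ := hCdense.inter_open_nonempty V hV ⟨x, hxV⟩
  exact ⟨y, hVU ⟨hyV, hCD hyC⟩, hyC⟩

end TraceTopology

theorem eq_of_homeomorph_of_forall_continuous_eq_id {X : Type*} {τ σ : TopologicalSpace X}
    (h : ∀ f : X → X, Continuous[τ, σ] f → Injective f → f = id) {S : Set X}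
    (e : @Homeomorph X S τ (TopologicalSpace.induced Subtype.val σ)) :
    τ = σ ∧ S = Set.univ := by
  let σS : TopologicalSpace S := .induced Subtype.val σ
  have hid : Subtype.val ∘ e = id := h _
    (@Continuous.comp X S X τ σS σ e _ continuous_induced_dom (@Homeomorph.continuous X S τ σS e))
    (Subtype.val_injective.comp (@Homeomorph.injective X S τ σS e))
  have hval (x : X) : (e x : X) = x := congrFun hid x
  refine ⟨?_, eq_univ_of_forall fun x => hval x ▸ (e x).2⟩
  exact calc
    τ = .induced e σS := @IsInducing.eq_induced X S τ σS e (@Homeomorph.isInducing X S τ σS e)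
    _ = .induced (Subtype.val ∘ e) σ := induced_compose
    _ = σ := by rw [hid, induced_id]

section PinnedTopology

variable {X : Type*} [t : TopologicalSpace X] {D : Set X} {p : X} {G H : Filter X}

/-- The trace topology of `D`, coarsened at `p` so that the neighbourhoods of `p` must in addition
belong to `G`. -/
abbrev pinnedTopology (D : Set X) (p : X) (G : Filter X) : TopologicalSpace X :=
  traceTopology D ⊔ nhdsAdjoint p G

theorem traceTopology_le_pinnedTopology : traceTopology D ≤ pinnedTopology D p G :=
  le_sup_left

theorem pinnedTopology_le (hG : G ≤ 𝓝 p) : pinnedTopology D p G ≤ t :=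
  sup_le traceTopology_le ((gc_nhds p).l_le hG)

theorem isOpen_pinnedTopology_of_subset {U : Set X} (hU : D ⊆ U) (hG : p ∈ U → U ∈ G) :
    IsOpen[pinnedTopology D p G] U :=
  ⟨isOpen_traceTopology_of_subset hU, hG⟩

theorem isOpen_pinnedTopology_insert {x : X} (hp : p ∉ D) (hx : x ≠ p) :
    IsOpen[pinnedTopology D p G] (insert x D) :=
  isOpen_pinnedTopology_of_subset (subset_insert x D) fun h =>
    absurd h (by simp [hp, hx.symm])

theorem le_nhds_pinnedTopology_iff (hH : (insert p D)ᶜ ∈ H) :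
    H ≤ @nhds X (pinnedTopology D p G) p ↔ H ≤ G := by
  refine ⟨fun h A hA => ?_, fun h => h.trans ((gc_nhds p).le_u le_sup_right)⟩
  have hopen : IsOpen[pinnedTopology D p G] (insert p D ∪ A) :=
    isOpen_pinnedTopology_of_subset ((subset_insert p D).trans subset_union_left) fun _ =>
      mem_of_superset hA subset_union_right
  filter_upwards [h (@IsOpen.mem_nhds X (pinnedTopology D p G) p _ hopen (Or.inl (mem_insert p D))),
    hH] with y hy hyD using hy.resolve_left hyD

theorem injOn_pinnedTopology : InjOn (pinnedTopology D p) {G | (insert p D)ᶜ ∈ G} :=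
  fun _ hG _ hH h => le_antisymm
    ((le_nhds_pinnedTopology_iff hG).1 (h ▸ (le_nhds_pinnedTopology_iff hG).2 le_rfl))
    ((le_nhds_pinnedTopology_iff hH).1 (h ▸ (le_nhds_pinnedTopology_iff hH).2 le_rfl))

theorem nhds_ne_nhds_pinnedTopology [T1Space X] [∀ x : X, (𝓝[≠] x).NeBot] (hD : Dense Dᶜ)
    (hp : p ∉ D) (hG : G < 𝓝[(insert p D)ᶜ] p) (x : X) :
    𝓝 x ≠ @nhds X (pinnedTopology D p G) x := by
  intro h
  obtain rfl | hx := eq_or_ne x p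
  · refine hG.not_ge ((le_nhds_pinnedTopology_iff self_mem_nhdsWithin).1 ?_)
    exact h ▸ nhdsWithin_le_nhds
  · have hmem : insert x D ∈ 𝓝 x := h ▸ @IsOpen.mem_nhds X (pinnedTopology D p G) x _
      (isOpen_pinnedTopology_insert hp hx) (mem_insert x D)
    obtain ⟨y, hy, hyD, hyx⟩ := mem_closure_iff_nhds.1 (hD.sdiff_singleton x x) _ hmem
    exact hy.elim hyx hyD

theorem le_mk_of_mem_nhdsWithin_compl_insert [T1Space X] [(𝓝[≠] p).NeBot] {κ : Cardinal}
    (hD : ∀ U : Set X, IsOpen U → U.Nonempty → κ ≤ #↥(U \ D)) {s : Set X}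
    (hs : s ∈ 𝓝[(insert p D)ᶜ] p) : κ ≤ #s := by
  obtain ⟨V, hV, hpV, hVs⟩ := mem_nhdsWithin.1 hs
  have hne : (V \ {p}).Nonempty :=
    ((infinite_of_mem_nhds p (hV.mem_nhds hpV)).sdiff (finite_singleton p)).nonempty
  refine (hD _ (hV.sdiff isClosed_singleton) hne).trans (mk_le_mk_of_subset ?_)
  exact fun y hy => hVs ⟨hy.1.1, fun h => h.elim hy.1.2 hy.2⟩

theorem eq_id_of_continuous_pinnedTopology [T3Space X] [∀ x : X, (𝓝[≠] x).NeBot] (hD : Dense D)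
    (hrigid : IsRigid D) (hp : p ∉ D) (hH : H ≤ 𝓝 p) {f : X → X}
    (hf : Continuous[pinnedTopology D p G, pinnedTopology D p H] f) (hinj : Injective f) :
    f = id := by
  have hcont : Continuous f := continuous_of_traceTopology_le hD traceTopology_le_pinnedTopology
    (continuous_le_rng (pinnedTopology_le hH) hf)
  have hdense : Dense (Set.univ \ f ⁻¹' {p}) :=
    dense_univ.sdiff_finite ((finite_singleton p).preimage hinj.injOn)
  refine hcont.ext_on hdense continuous_id fun x hx => by_contra fun hfx => ?_
  have hpre : f ⁻¹' insert (f x) D ∈ 𝓝[D] x :=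
    isOpen_traceTopology_iff.1 (traceTopology_le_pinnedTopology _
      (continuous_def.1 hf _ (isOpen_pinnedTopology_insert hp hx.2))) x (mem_insert _ _)
  obtain ⟨V, hV, hxV, hVf⟩ := mem_nhdsWithin.1 hpre
  have hopen : IsOpen (V ∩ {y | f y ≠ y}) := hV.inter (isOpen_ne_fun hcont continuous_id)
  obtain ⟨y, ⟨⟨hyV, -⟩, hyx⟩, hyD, hfy⟩ := hrigid f hcont hinj ((V ∩ {y | f y ≠ y}) \ {x})
    (hopen.sdiff isClosed_singleton)
    ((infinite_of_mem_nhds x (hopen.mem_nhds ⟨hxV, hfx⟩)).sdiff (finite_singleton x)).nonempty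
    fun y hy => hy.1.2
  exact hyx (hinj ((hVf ⟨hyV, hyD⟩).resolve_right hfy))

end PinnedTopology

theorem theorem6_general {X : Type u} [t : TopologicalSpace X] [T3Space X]
    [SecondCountableTopology X] [ConnectedSpace X] [Nontrivial X] :
    ∃ 𝒮 : Set (TopologicalSpace X),
      #𝒮 = (2 : Cardinal.{u}) ^ (2 : Cardinal.{u}) ^ 𝔠 ∧
      (∀ τ ∈ 𝒮, τ ≤ t ∧ (∀ x, 𝓝 x ≠ @nhds X τ x) ∧
        @T2Space X τ ∧ @TopologicalSpace.SeparableSpace X τ ∧ @ConnectedSpace X τ) ∧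
      Incomparable 𝒮 := by
  have hopen (U : Set X) (hU : IsOpen U) (hne : U.Nonempty) : 𝔠 ≤ #U :=
    continuum_le_mk_of_isOpen hU hne
  have hX : #X = 𝔠 := mk_le_continuum_of_secondCountable.antisymm
    (mk_univ (α := X) ▸ hopen Set.univ isOpen_univ univ_nonempty)
  obtain ⟨D, hrigid, hD, hDc⟩ := exists_isRigid hopen
  have hDc' : Dense Dᶜ :=
    dense_iff_inter_open.2 fun U hU hne => nonempty_of_continuum_le_mk (hDc U hU hne)
  obtain ⟨p, hp⟩ := hDc'.nonempty
  let l := 𝓝[(insert p D)ᶜ] p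
  refine ⟨pinnedTopology D p '' Iio l, ?_, ?_, ?_⟩
  · have hinj : InjOn (pinnedTopology D p) (Iio l) :=
      injOn_pinnedTopology.mono fun G hG => (mem_Iio.1 hG).le self_mem_nhdsWithin
    rw [mk_image_eq_of_injOn _ _ hinj, ← hX]
    exact mk_Iio_filter (hX ▸ aleph0_lt_continuum) fun s hs =>
      hX ▸ le_mk_of_mem_nhdsWithin_compl_insert hDc hs
  · rintro _ ⟨G, hG, rfl⟩
    have hGp : G ≤ 𝓝 p := hG.le.trans nhdsWithin_le_nhds
    exact ⟨pinnedTopology_le hGp, nhds_ne_nhds_pinnedTopology hDc' hp hG,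
      t2Space_antitone (pinnedTopology_le hGp) inferInstance,
      separableSpace_of_traceTopology_le hD traceTopology_le_pinnedTopology,
      connectedSpace_of_traceTopology_le hD traceTopology_le_pinnedTopology⟩
  · rintro _ ⟨G, -, rfl⟩ _ ⟨H, hH, rfl⟩ S ⟨e⟩
    exact eq_of_homeomorph_of_forall_continuous_eq_id (fun f =>
      eq_id_of_continuous_pinnedTopology hD hrigid hp (hH.le.trans nhdsWithin_le_nhds)) e

theorem theorem6 :
    ∃ 𝒮 : Set (TopologicalSpace ℝ),
      Cardinal.mk 𝒮 = (2 : Cardinal.{0}) ^ ((2 : Cardinal.{0}) ^ Cardinal.continuum.{0}) ∧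
      (∀ τ ∈ 𝒮, τ ∈ refinements ∧ strictPoints τ = Set.univ ∧
        @T2Space ℝ τ ∧ @TopologicalSpace.SeparableSpace ℝ τ ∧ @ConnectedSpace ℝ τ) ∧
      Incomparable 𝒮 := by
  obtain ⟨𝒮, hcard, h𝒮, hinc⟩ := theorem6_general (X := ℝ)
  exact ⟨𝒮, hcard, fun τ hτ => (h𝒮 τ hτ).imp id (And.imp eq_univ_of_forall id), hinc⟩
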